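/- Let $H^2(\mathbb{D})$ be the Hardy space of all holomorphic functions $f$ on the open unit disc $\mathbb{D}$ with $$\|f\|_2=\Big(\sup_{0<r<1}\frac1{2\pi}\int_0^{2\pi}|f(re^{i\theta})|^2\,d\theta\Big)^{1/2}<\infty .$$ A bounded linear operator $T$ on a complex normed space $X$ has the \emph{positive shadowing property} if for every $\varepsilon>0$ there is $\delta>0$ such that for every sequence $(x_n)_{n\ge1}$ in $X$ with $\|Tx_n-x_{n+1}\|\le\delta$ for all $n\ge1$ there is $x\in X$ with $\|T^nx-x_n\|\le\varepsilon$ for all $n\ge1$. A \emph{parabolic self-map} of $\mathbb{D}$ is a map $\phi:\mathbb{D}\to\mathbb{D}$ of the form $\phi(z)=\frac{az+b}{cz+d}$ with $a,b,c,d\in\mathbb{C}$ and $ad-bc\ne0$ which, as a transformation of the Riemann sphere $\mathbb{C}\cup\{\infty\}$, has exactly one fixed point; it may or may not be an automorphism of $\mathbb{D}$. \textbf{Theorem.} Let $\phi$ be a parabolic self-map of $\mathbb{D}$. Then the composition operator $C_\phi f=f\circ\phi$ is a bounded linear operator on $H^2(\mathbb{D})$, and it does not have the positive shadowing property. -/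

import Mathlib

noncomputable section

open Complex MeasureTheory Set
open scoped UnitDisc ENNReal

namespace HardyShadowing

/-! ### The Hardy space of the unit disc -/

/-- Extension by zero to the plane of a function on the open unit disc. -/
def discExt (f : 𝔻 → ℂ) (z : ℂ) : ℂ :=
  if h : ‖z‖ < 1 then f (UnitDisc.mk z h) else 0

/-- Holomorphic functions on the open unit disc. -/
def IsHolomorphicOnDisc (f : 𝔻 → ℂ) : Prop :=
  DifferentiableOn ℂ (discExt f) (Metric.ball 0 1)

/-- The integral mean `(1 / 2π) ∫₀^{2π} |f (r e^{iθ})|² dθ`. -/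
def integralMean (f : 𝔻 → ℂ) (r : ℝ) : ℝ≥0∞ :=
  (ENNReal.ofReal (2 * Real.pi))⁻¹ *
    ∫⁻ θ in Ioc 0 (2 * Real.pi), ‖discExt f (circleMap 0 r θ)‖ₑ ^ 2

/-- The Hardy norm `(sup_{0 < r < 1} (1 / 2π) ∫₀^{2π} |f (r e^{iθ})|² dθ)^{1/2}`, possibly `∞`. -/
def eHardyNorm (f : 𝔻 → ℂ) : ℝ≥0∞ :=
  (⨆ r ∈ Ioo (0 : ℝ) 1, integralMean f r) ^ (1 / 2 : ℝ)

/-! #### Facts needed for the normed space structure -/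

/-- The normalized measure on a period. -/
def circMeasure : Measure ℝ :=
  (ENNReal.ofReal (2 * Real.pi))⁻¹ • volume.restrict (Ioc 0 (2 * Real.pi))

theorem discExt_coe (f : 𝔻 → ℂ) (z : 𝔻) : discExt f z = f z := by
  simp [discExt, z.norm_lt_one]

theorem discExt_add (f g : 𝔻 → ℂ) : discExt (f + g) = discExt f + discExt g := by
  ext z; by_cases h : ‖z‖ < 1 <;> simp [discExt, h]

theorem discExt_smul (c : ℂ) (f : 𝔻 → ℂ) : discExt (c • f) = c • discExt f := by
  ext z; by_cases h : ‖z‖ < 1 <;> simp [discExt, h]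

theorem discExt_zero : discExt 0 = 0 := by
  ext z; simp [discExt]

theorem eHardyNorm_eq (f : 𝔻 → ℂ) :
    eHardyNorm f =
      ⨆ r ∈ Ioo (0 : ℝ) 1, eLpNorm (fun θ => discExt f (circleMap 0 r θ)) 2 circMeasure := by
  have h (r : ℝ) : eLpNorm (fun θ => discExt f (circleMap 0 r θ)) 2 circMeasure =
      integralMean f r ^ (1 / 2 : ℝ) := by
    rw [eLpNorm_eq_lintegral_rpow_enorm_toReal (by norm_num) (by norm_num)]
    simp [circMeasure, integralMean, lintegral_smul_measure]
  simp only [h, eHardyNorm]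
  exact (ENNReal.orderIsoRpow (1 / 2 : ℝ) (by norm_num)).map_iSup₂
    (fun (r : ℝ) (_ : r ∈ Ioo (0 : ℝ) 1) => integralMean f r)

theorem continuous_circle {f : 𝔻 → ℂ} (hf : IsHolomorphicOnDisc f) {r : ℝ}
    (hr : r ∈ Ioo (0 : ℝ) 1) : Continuous fun θ => discExt f (circleMap 0 r θ) := by
  refine hf.continuousOn.comp_continuous (continuous_circleMap 0 r) fun θ => ?_
  simp [abs_of_pos hr.1, hr.2]

theorem eHardyNorm_add_le {f g : 𝔻 → ℂ} (hf : IsHolomorphicOnDisc f)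
    (hg : IsHolomorphicOnDisc g) : eHardyNorm (f + g) ≤ eHardyNorm f + eHardyNorm g := by
  simp only [eHardyNorm_eq]
  refine iSup₂_le fun r hr => ?_
  rw [discExt_add]
  refine (eLpNorm_add_le (continuous_circle hf hr).aestronglyMeasurable
    (continuous_circle hg hr).aestronglyMeasurable (by norm_num)).trans ?_
  exact add_le_add
    (le_iSup₂ (f := fun r (_ : r ∈ Ioo (0 : ℝ) 1) =>
      eLpNorm (fun θ => discExt f (circleMap 0 r θ)) 2 circMeasure) r hr)
    (le_iSup₂ (f := fun r (_ : r ∈ Ioo (0 : ℝ) 1) =>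
      eLpNorm (fun θ => discExt g (circleMap 0 r θ)) 2 circMeasure) r hr)

theorem eHardyNorm_smul (c : ℂ) (f : 𝔻 → ℂ) :
    eHardyNorm (c • f) = ‖c‖ₑ * eHardyNorm f := by
  simp only [eHardyNorm_eq, ENNReal.mul_iSup]
  refine iSup_congr fun r => iSup_congr fun _ => ?_
  rw [discExt_smul]
  exact eLpNorm_const_smul c _ 2 _

theorem eHardyNorm_zero : eHardyNorm 0 = 0 := by
  simpa using eHardyNorm_smul 0 0

theorem eq_zero_of_eHardyNorm_eq_zero {f : 𝔻 → ℂ} (hf : IsHolomorphicOnDisc f)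
    (h : eHardyNorm f = 0) : f = 0 := by
  have key : ∀ z : ℂ, z ≠ 0 → discExt f z = 0 := by
    intro z hz
    by_cases hz1 : ‖z‖ < 1
    swap
    · simp [discExt, hz1]
    have hr : ‖z‖ ∈ Ioo (0 : ℝ) 1 := ⟨norm_pos_iff.2 hz, hz1⟩
    have hc := continuous_circle hf hr
    have hsup : (⨆ r ∈ Ioo (0 : ℝ) 1, integralMean f r) = 0 := by
      exact (ENNReal.rpow_eq_zero_iff_of_pos (by norm_num)).1 h
    have h0 : integralMean f ‖z‖ = 0 :=
      le_antisymm (hsup ▸ le_iSup₂ (f := fun r (_ : r ∈ Ioo (0 : ℝ) 1) => integralMean f r)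
        _ hr) bot_le
    have h1 : ∫⁻ θ in Ioc 0 (2 * Real.pi), ‖discExt f (circleMap 0 ‖z‖ θ)‖ₑ ^ 2 = 0 := by
      exact (mul_eq_zero.1 h0).resolve_left (ENNReal.inv_ne_zero.2 ENNReal.ofReal_ne_top)
    rw [lintegral_eq_zero_iff (hc.measurable.enorm.pow_const 2)] at h1
    have h2 : (fun θ => discExt f (circleMap 0 ‖z‖ θ))
        =ᵐ[volume.restrict (Ioc 0 (2 * Real.pi))] fun _ => 0 := by
      filter_upwards [h1] with θ hθ
      simpa using hθ
    have h3 := Measure.eqOn_Ioc_of_ae_eq volume h2 hc.continuousOn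
      continuousOn_const
    have h4 : z ∈ circleMap 0 ‖z‖ '' Ioc 0 (2 * Real.pi) := by
      simp [image_circleMap_Ioc]
    obtain ⟨θ, hθ, hzθ⟩ := h4
    simpa [hzθ] using h3 hθ
  have h0 : discExt f 0 = 0 := by
    have hc : ContinuousAt (discExt f) 0 :=
      (hf.differentiableAt (Metric.ball_mem_nhds 0 one_pos)).continuousAt
    refine tendsto_nhds_unique (hc.tendsto.mono_left (nhdsWithin_le_nhds (s := {0}ᶜ))) ?_
    refine tendsto_const_nhds.congr' ?_
    filter_upwards [self_mem_nhdsWithin] with z hz using (key z hz).symm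
  ext z
  rw [← discExt_coe f z]
  by_cases hz : (z : ℂ) = 0
  · rw [hz, h0]; rfl
  · exact key _ hz

/-- The functions in `H²(𝔻)`, as a linear subspace of all functions on the disc. -/
def hardySubmodule : Submodule ℂ (𝔻 → ℂ) where
  carrier := {f | IsHolomorphicOnDisc f ∧ eHardyNorm f < ⊤}
  zero_mem' := by
    refine ⟨?_, by simp [eHardyNorm_zero]⟩
    rw [IsHolomorphicOnDisc, discExt_zero]
    exact differentiableOn_const 0
  add_mem' := by
    rintro f g ⟨hf, hf'⟩ ⟨hg, hg'⟩
    refine ⟨?_, (eHardyNorm_add_le hf hg).trans_lt (ENNReal.add_lt_top.2 ⟨hf', hg'⟩)⟩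
    rw [IsHolomorphicOnDisc, discExt_add]
    exact DifferentiableOn.add hf hg
  smul_mem' := by
    rintro c f ⟨hf, hf'⟩
    refine ⟨?_, ?_⟩
    · rw [IsHolomorphicOnDisc, discExt_smul]
      exact DifferentiableOn.const_smul hf c
    · rw [eHardyNorm_smul]
      exact ENNReal.mul_lt_top (by simp) hf'

/-- The Hardy space `H²(𝔻)`; its topology is the one given by the Hardy norm below (not the
topology of pointwise convergence inherited from `𝔻 → ℂ`). -/
def HardySpace : Type := hardySubmodule

namespace HardySpace

instance : AddCommGroup HardySpace := inferInstanceAs (AddCommGroup hardySubmodule)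

instance : Module ℂ HardySpace := inferInstanceAs (Module ℂ hardySubmodule)

instance : CoeFun HardySpace fun _ => 𝔻 → ℂ := ⟨fun f => Subtype.val f⟩

/-- The Hardy norm. -/
instance : Norm HardySpace := ⟨fun f => (eHardyNorm f).toReal⟩

theorem norm_def (f : HardySpace) : ‖f‖ = (eHardyNorm f).toReal := rfl

theorem ext {f g : HardySpace} (h : ∀ z, f z = g z) : f = g := Subtype.ext (funext h)

theorem normCore : NormedSpace.Core ℂ HardySpace where
  norm_nonneg _ := ENNReal.toReal_nonneg
  norm_smul c f := by
    have : eHardyNorm (c • f : HardySpace) = ‖c‖ₑ * eHardyNorm f := eHardyNorm_smul c f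
    simp [norm_def, this]
  norm_triangle f g := by
    simp only [norm_def]
    rw [← ENNReal.toReal_add f.2.2.ne g.2.2.ne]
    exact ENNReal.toReal_mono (ENNReal.add_ne_top.2 ⟨f.2.2.ne, g.2.2.ne⟩)
      (eHardyNorm_add_le f.2.1 g.2.1)
  norm_eq_zero_iff f := by
    constructor
    · intro h
      have h' : eHardyNorm f = 0 :=
        ((ENNReal.toReal_eq_zero_iff _).1 h).resolve_right f.2.2.ne
      exact Subtype.ext (eq_zero_of_eHardyNorm_eq_zero f.2.1 h')
    · rintro rfl
      have : eHardyNorm (0 : HardySpace) = 0 := eHardyNorm_zero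
      simp [norm_def, this]

instance : NormedAddCommGroup HardySpace := NormedAddCommGroup.ofCore normCore

instance : NormedSpace ℂ HardySpace := NormedSpace.ofCore normCore

end HardySpace

/-! ### Shadowing -/

/-- A `δ`-pseudo-orbit `(x_n)_{n ≥ 1}` of `T` (the value `x 0` plays no role). -/
def IsPseudoOrbit {X : Type*} [NormedAddCommGroup X] [NormedSpace ℂ X] (T : X →L[ℂ] X) (δ : ℝ)
    (x : ℕ → X) : Prop :=
  ∀ n, 1 ≤ n → ‖T (x n) - x (n + 1)‖ ≤ δ

/-- The positive shadowing property. -/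
def HasPositiveShadowing {X : Type*} [NormedAddCommGroup X] [NormedSpace ℂ X]
    (T : X →L[ℂ] X) : Prop :=
  ∀ ε > 0, ∃ δ > 0, ∀ x : ℕ → X, IsPseudoOrbit T δ x →
    ∃ y : X, ∀ n, 1 ≤ n → ‖(T ^ n) y - x n‖ ≤ ε

/-! ### Composition operators and parabolic self-maps -/

/-- `T` is the composition operator `C_φ f = f ∘ φ` on `H²(𝔻)`. -/
def IsCompositionOperator (φ : 𝔻 → 𝔻) (T : HardySpace →L[ℂ] HardySpace) : Prop :=
  ∀ (f : HardySpace) (z : 𝔻), T f z = f (φ z)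

theorem IsCompositionOperator.unique {φ : 𝔻 → 𝔻} {S T : HardySpace →L[ℂ] HardySpace}
    (hS : IsCompositionOperator φ S) (hT : IsCompositionOperator φ T) : S = T :=
  ContinuousLinearMap.ext fun f => HardySpace.ext fun z => (hS f z).trans (hT f z).symm

/-- `φ` is the restriction to the disc of the Möbius transformation `z ↦ (a z + b) / (c z + d)`
of the Riemann sphere `OnePoint ℂ` given by the invertible matrix `g = (a b; c d)`. -/
def IsInducedBy (φ : 𝔻 → 𝔻) (g : GL (Fin 2) ℂ) : Prop :=
  ∀ z : 𝔻, g • ((z : ℂ) : OnePoint ℂ) = ((φ z : ℂ) : OnePoint ℂ)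

theorem isInducedBy_iff (φ : 𝔻 → 𝔻) (g : GL (Fin 2) ℂ) :
    IsInducedBy φ g ↔ ∀ z : 𝔻, g 1 0 * z + g 1 1 ≠ 0 ∧
      (φ z : ℂ) = (g 0 0 * z + g 0 1) / (g 1 0 * z + g 1 1) := by
  refine forall_congr' fun z => ?_
  rw [OnePoint.smul_some_eq_ite]
  by_cases h : g 1 0 * (z : ℂ) + g 1 1 = 0
  · simp [h, OnePoint.infty_ne_coe]
  · simp [h, eq_comm]

/-- A parabolic self-map of the disc: a linear fractional self-map with exactly one fixed point
on the Riemann sphere. -/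
def IsParabolicSelfMap (φ : 𝔻 → 𝔻) : Prop :=
  ∃ g : GL (Fin 2) ℂ, IsInducedBy φ g ∧ ∃! p : OnePoint ℂ, g • p = p

end HardyShadowing

end

/-!
Iterating a parabolic matrix `λ + N`, `N² = 0`, gives `λⁿ⁻¹ (λ + n N)`, so the points of an orbit
of a parabolic self-map are quotients of affine functions of `n`, and `1 - |φⁿ(z)|²` is a quotient
of two polynomials in `n` of degree at most two. A polynomial with positive values at the integers
is eventually bounded away from `0`, so `1 - |φⁿ(z)|² ≥ c / n²` for large `n`. On the other hand,
Parseval's identity and the Cauchy–Schwarz inequality show that every `f ∈ H²` is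
`o((1 - |z|²)^{-1/2})` at the boundary, so that `f (φⁿ(z)) = o(n)`.

Constants are fixed by `C_φ`, so for small `d > 0` the sequence of constants `d n` is a
pseudo-orbit. A function `f` shadowing it would have `f (φⁿ(z)) - d n` bounded, a contradiction.

Boundedness of `C_φ` is Littlewood's subordination principle: integrate the Poisson representation
of `f` over the curve `φ(r e^{iθ})`, and use that `z ↦ P(φ(z), w)` is the real part of a
holomorphic function, hence has mean `P(φ(0), w)` on circles about `0`.
-/

noncomputable section

open Complex MeasureTheory Set Filter Metric Real InnerProductSpace
open scoped UnitDisc ENNReal Topology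

namespace HardyShadowing

/-! ### Circle averages and subordination -/

theorem norm_circleAverage_le_circleAverage_norm {E : Type*} [NormedAddCommGroup E]
    [NormedSpace ℝ E] (f : ℂ → E) (c : ℂ) (R : ℝ) :
    ‖circleAverage f c R‖ ≤ circleAverage (fun z => ‖f z‖) c R := by
  rw [circleAverage_def, circleAverage_def, norm_smul, smul_eq_mul,
    Real.norm_of_nonneg (by positivity)]
  gcongr
  exact intervalIntegral.norm_integral_le_integral_norm two_pi_pos.le

theorem circleAverage_circleAverage_swap {E : Type*} [NormedAddCommGroup E] [NormedSpace ℝ E]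
    {f : ℂ → ℂ → E} {c d : ℂ} {r R : ℝ}
    (hf : ContinuousOn (Function.uncurry f) (sphere c |r| ×ˢ sphere d |R|)) :
    circleAverage (fun z => circleAverage (f z) d R) c r =
      circleAverage (fun w => circleAverage (fun z => f z w) c r) d R := by
  have hcont : Continuous fun p : ℝ × ℝ => f (circleMap c r p.1) (circleMap d R p.2) :=
    hf.comp_continuous (f := fun p : ℝ × ℝ => (circleMap c r p.1, circleMap d R p.2))
      (by fun_prop) fun p => ⟨circleMap_mem_sphere' c r p.1, circleMap_mem_sphere' d R p.2⟩
  simp only [circleAverage_def, intervalIntegral.integral_smul]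
  rw [intervalIntegral_intervalIntegral_swap]
  exact (hcont.continuousOn.integrableOn_compact (isCompact_uIcc.prod isCompact_uIcc)).mono_set
    (prod_mono uIoc_subset_uIcc uIoc_subset_uIcc)

theorem continuousOn_circleAverage_of_uncurry {X E : Type*} [TopologicalSpace X]
    [NormedAddCommGroup E] [NormedSpace ℝ E] {f : X → ℂ → E} {s : Set X} {c : ℂ} {R : ℝ}
    (hf : ContinuousOn (Function.uncurry f) (s ×ˢ sphere c |R|)) :
    ContinuousOn (fun x => circleAverage (f x) c R) s := by
  rw [continuousOn_iff_continuous_domRestrict]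
  refine .const_smul
    (intervalIntegral.continuous_parametric_intervalIntegral_of_continuous' ?_ _ _) _
  exact hf.comp_continuous (f := fun p : s × ℝ => ((p.1 : X), circleMap c R p.2)) (by fun_prop)
    fun p => ⟨p.1.2, circleMap_mem_sphere' c R p.2⟩

/-- Schur's test for averages over circles. -/
theorem circleAverage_le_mul_of_le_circleAverage_mul {K : ℂ → ℂ → ℝ} {u v : ℂ → ℝ} {c d : ℂ}
    {r R M : ℝ} (hK : ContinuousOn (Function.uncurry K) (sphere c |r| ×ˢ sphere d |R|))
    (hu : ContinuousOn u (sphere c |r|)) (hv : ContinuousOn v (sphere d |R|))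
    (hv_nonneg : ∀ w ∈ sphere d |R|, 0 ≤ v w)
    (huv : ∀ z ∈ sphere c |r|, u z ≤ circleAverage (fun w => K z w * v w) d R)
    (hM : ∀ w ∈ sphere d |R|, circleAverage (fun z => K z w) c r ≤ M) :
    circleAverage u c r ≤ M * circleAverage v d R := by
  have hKv : ContinuousOn (Function.uncurry fun z w => K z w * v w)
      (sphere c |r| ×ˢ sphere d |R|) :=
    hK.mul (hv.comp continuousOn_snd fun _ hp => hp.2)
  have hK_swap : ContinuousOn (Function.uncurry fun w z => K z w)
      (sphere d |R| ×ˢ sphere c |r|) :=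
    hK.comp continuous_swap.continuousOn fun _ hp => hp.symm
  calc circleAverage u c r
      ≤ circleAverage (fun z => circleAverage (fun w => K z w * v w) d R) c r :=
        circleAverage_mono hu.circleIntegrable'
          (continuousOn_circleAverage_of_uncurry hKv).circleIntegrable' huv
    _ = circleAverage (fun w => circleAverage (fun z => K z w) c r * v w) d R := by
        rw [circleAverage_circleAverage_swap hKv]
        simp only [mul_comm _ (v _), ← smul_eq_mul, circleAverage_fun_smul]
    _ ≤ circleAverage (fun w => M * v w) d R :=
        circleAverage_mono
          ((continuousOn_circleAverage_of_uncurry hK_swap).mul hv).circleIntegrable'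
          (continuousOn_const.mul hv).circleIntegrable' fun w hw =>
            mul_le_mul_of_nonneg_right (hM w hw) (hv_nonneg w hw)
    _ = M * circleAverage v d R := by
        simp only [← smul_eq_mul, circleAverage_fun_smul]

theorem poissonKernel_nonneg {c w z : ℂ} {R : ℝ} (hz : z ∈ sphere c R) (hw : w ∈ ball c R) :
    0 ≤ poissonKernel c w z := by
  rw [poissonKernel_eq_re_herglotzRieszKernel]
  have hwR : ‖w - c‖ < R := mem_ball_iff_norm.1 hw
  exact (div_nonneg (by linarith) (by linarith [norm_nonneg (w - c)])).trans
    (le_re_herglotzRieszKernel hz hw)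

theorem norm_le_circleAverage_poissonKernel_mul_norm {E : Type*} [NormedAddCommGroup E]
    [NormedSpace ℂ E] [CompleteSpace E] {F : ℂ → E} {c w : ℂ} {R : ℝ}
    (hF : DiffContOnCl ℂ F (ball c R)) (hw : w ∈ ball c R) :
    ‖F w‖ ≤ circleAverage (fun z => poissonKernel c w z * ‖F z‖) c R := by
  have hR : 0 < R := pos_of_mem_ball hw
  calc ‖F w‖ = ‖circleAverage (poissonKernel c w • F) c R‖ := by
        rw [hF.circleAverage_poissonKernel_smul hw]
    _ ≤ circleAverage (fun z => ‖poissonKernel c w z • F z‖) c R :=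
        norm_circleAverage_le_circleAverage_norm _ c R
    _ = circleAverage (fun z => poissonKernel c w z * ‖F z‖) c R := by
        refine circleAverage_congr_sphere fun z hz => ?_
        rw [abs_of_pos hR] at hz
        simp only [norm_smul, Real.norm_of_nonneg (poissonKernel_nonneg hz hw)]

theorem differentiableOn_herglotzRieszKernel_ball {c z : ℂ} {R : ℝ} (hz : z ∈ sphere c R) :
    DifferentiableOn ℂ (fun w => herglotzRieszKernel c w z) (ball c R) := by
  simp only [herglotzRieszKernel_def]
  refine DifferentiableOn.div (by fun_prop) (by fun_prop) fun w hw h => ?_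
  rw [sub_sub_sub_cancel_right, sub_eq_zero] at h
  exact sphere_disjoint_ball.le_bot ⟨hz, h ▸ hw⟩

theorem continuousOn_poissonKernel (c : ℂ) (R : ℝ) :
    ContinuousOn (fun p : ℂ × ℂ => poissonKernel c p.1 p.2) (ball c R ×ˢ sphere c R) := by
  simp only [poissonKernel_def]
  refine ContinuousOn.div (by fun_prop) (by fun_prop) fun p hp h => ?_
  rw [sq_eq_zero_iff, norm_eq_zero, sub_sub_sub_cancel_right, sub_eq_zero] at h
  exact sphere_disjoint_ball.le_bot ⟨hp.2, h ▸ hp.1⟩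

theorem circleAverage_poissonKernel_comp_le {G : ℂ → ℂ} {c d w : ℂ} {r R : ℝ} (hr : 0 < r)
    (hG : DiffContOnCl ℂ G (ball c r)) (hGm : MapsTo G (closedBall c r) (ball d R))
    (hw : w ∈ sphere d R) :
    circleAverage (fun z => poissonKernel d (G z) w) c r ≤
      (R + ‖G c - d‖) / (R - ‖G c - d‖) := by
  have hH := differentiableOn_herglotzRieszKernel_ball hw
  have hcont : ContinuousOn (fun z => herglotzRieszKernel d (G z) w) (closedBall c r) :=
    hH.continuousOn.comp hG.continuousOn_ball hGm
  have hdiff : DiffContOnCl ℂ (fun z => herglotzRieszKernel d (G z) w) (ball c |r|) := by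
    rw [abs_of_pos hr]
    exact .mk_ball (hH.comp hG.differentiableOn (hGm.mono_left ball_subset_closedBall)) hcont
  have hint : CircleIntegrable (fun z => herglotzRieszKernel d (G z) w) c r :=
    (hcont.mono sphere_subset_closedBall).circleIntegrable hr.le
  calc circleAverage (fun z => poissonKernel d (G z) w) c r
      = circleAverage (reCLM ∘ fun z => herglotzRieszKernel d (G z) w) c r := by
        simp only [poissonKernel_eq_re_herglotzRieszKernel]
        rfl
    _ = (herglotzRieszKernel d (G c) w).re := by
        rw [reCLM.circleAverage_comp_comm hint, hdiff.circleAverage, reCLM_apply]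
    _ ≤ (R + ‖G c - d‖) / (R - ‖G c - d‖) :=
        re_herglotzRieszKernel_le hw (hGm (mem_closedBall_self hr.le))

/-- Littlewood's subordination principle. -/
theorem circleAverage_norm_comp_le {E : Type*} [NormedAddCommGroup E]
    [NormedSpace ℂ E] [CompleteSpace E] {F : ℂ → E} {G : ℂ → ℂ} {c d : ℂ} {r R : ℝ} (hr : 0 < r)
    (hF : DiffContOnCl ℂ F (ball d R)) (hG : DiffContOnCl ℂ G (ball c r))
    (hGm : MapsTo G (closedBall c r) (ball d R)) :
    circleAverage (fun z => ‖F (G z)‖) c r ≤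
      (R + ‖G c - d‖) / (R - ‖G c - d‖) * circleAverage (fun w => ‖F w‖) d R := by
  have hR : |R| = R := abs_of_pos (pos_of_mem_ball (hGm (mem_closedBall_self hr.le)))
  have hsphere : sphere c |r| ⊆ closedBall c r := by
    rw [abs_of_pos hr]
    exact sphere_subset_closedBall
  have hGs : MapsTo G (sphere c |r|) (ball d R) := hGm.mono_left hsphere
  have hGc : ContinuousOn G (sphere c |r|) := hG.continuousOn_ball.mono hsphere
  have hFc : ContinuousOn F (sphere d |R|) := by
    rw [hR]
    exact hF.continuousOn_ball.mono sphere_subset_closedBall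
  have hKc : ContinuousOn (Function.uncurry fun z w => poissonKernel d (G z) w)
      (sphere c |r| ×ˢ sphere d |R|) :=
    (continuousOn_poissonKernel d R).comp
      ((hGc.comp continuousOn_fst fun _ hp => hp.1).prodMk continuousOn_snd)
      fun _ hp => ⟨hGs hp.1, hR ▸ hp.2⟩
  refine circleAverage_le_mul_of_le_circleAverage_mul hKc
    (hF.differentiableOn.continuousOn.comp hGc hGs).norm hFc.norm (fun w _ => norm_nonneg _)
    (fun z hz => norm_le_circleAverage_poissonKernel_mul_norm hF (hGs hz)) fun w hw => ?_
  exact circleAverage_poissonKernel_comp_le hr hG hGm (hR ▸ hw)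

/-! ### Bounded composition operators -/

theorem integralMean_eq {f : 𝔻 → ℂ} (hf : IsHolomorphicOnDisc f) {r : ℝ}
    (hr : r ∈ Ioo (0 : ℝ) 1) :
    integralMean f r = ENNReal.ofReal (circleAverage (fun z => ‖discExt f z‖ ^ 2) 0 r) := by
  have hc : Continuous fun θ => ‖discExt f (circleMap 0 r θ)‖ ^ 2 :=
    (continuous_circle hf hr).norm.pow 2
  rw [circleAverage_def, intervalIntegral.integral_of_le two_pi_pos.le, smul_eq_mul,
    ENNReal.ofReal_mul (by positivity), ENNReal.ofReal_inv_of_pos two_pi_pos,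
    ofReal_integral_eq_lintegral_ofReal hc.integrableOn_Ioc (.of_forall fun θ => by positivity)]
  simp only [integralMean, ENNReal.ofReal_pow (norm_nonneg _), ofReal_norm]

theorem eHardyNorm_sq (f : 𝔻 → ℂ) :
    eHardyNorm f ^ 2 = ⨆ r ∈ Ioo (0 : ℝ) 1, integralMean f r := by
  rw [eHardyNorm, ← ENNReal.rpow_natCast, ← ENNReal.rpow_mul]
  norm_num

theorem integralMean_le_eHardyNorm_sq (f : 𝔻 → ℂ) {r : ℝ} (hr : r ∈ Ioo (0 : ℝ) 1) :
    integralMean f r ≤ eHardyNorm f ^ 2 :=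
  (le_iSup₂ (f := fun r (_ : r ∈ Ioo (0 : ℝ) 1) => integralMean f r) r hr).trans_eq
    (eHardyNorm_sq f).symm

theorem HardySpace.circleAverage_sq_norm_le (f : HardySpace) {r : ℝ} (hr : r ∈ Ioo (0 : ℝ) 1) :
    circleAverage (fun z => ‖discExt f z‖ ^ 2) 0 r ≤ ‖f‖ ^ 2 := by
  have h := integralMean_le_eHardyNorm_sq f hr
  rwa [integralMean_eq f.2.1 hr,
    ENNReal.ofReal_le_iff_le_toReal (ENNReal.pow_ne_top f.2.2.ne), ENNReal.toReal_pow] at h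

theorem discExt_comp {f : 𝔻 → ℂ} {φ : 𝔻 → 𝔻} {z : ℂ} (hz : ‖z‖ < 1) :
    discExt (f ∘ φ) z = discExt f (discExt (fun w => (φ w : ℂ)) z) := by
  lift z to 𝔻 using hz
  simp only [discExt_coe, Function.comp_apply]

theorem mapsTo_discExt_coe (φ : 𝔻 → 𝔻) :
    MapsTo (discExt fun z => (φ z : ℂ)) (ball 0 1) (ball 0 1) := by
  intro z hz
  lift z to 𝔻 using mem_ball_zero_iff.1 hz
  simpa only [discExt_coe, mem_ball_zero_iff] using (φ z).norm_lt_one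

theorem IsHolomorphicOnDisc.comp {f : 𝔻 → ℂ} {φ : 𝔻 → 𝔻} (hf : IsHolomorphicOnDisc f)
    (hφ : IsHolomorphicOnDisc fun z => (φ z : ℂ)) : IsHolomorphicOnDisc (f ∘ φ) :=
  (DifferentiableOn.comp hf hφ (mapsTo_discExt_coe φ)).congr fun _ hz =>
    discExt_comp (mem_ball_zero_iff.1 hz)

theorem integralMean_comp_le {f : 𝔻 → ℂ} {φ : 𝔻 → 𝔻} (hf : IsHolomorphicOnDisc f)
    (hφ : IsHolomorphicOnDisc fun z => (φ z : ℂ)) {r ρ : ℝ} (hr : r ∈ Ioo (0 : ℝ) 1)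
    (hρ : ρ ∈ Ioo (0 : ℝ) 1)
    (hmaps : MapsTo (discExt fun z => (φ z : ℂ)) (closedBall 0 r) (ball 0 ρ)) :
    integralMean (f ∘ φ) r ≤
      ENNReal.ofReal ((ρ + ‖(φ 0 : ℂ)‖) / (ρ - ‖(φ 0 : ℂ)‖)) * integralMean f ρ := by
  have hφ0 : discExt (fun z => (φ z : ℂ)) 0 = φ 0 := discExt_coe (fun z => (φ z : ℂ)) 0
  have hρ_pos : 0 < ρ - ‖(φ 0 : ℂ)‖ := by
    simpa only [hφ0, mem_ball_zero_iff, sub_pos] using hmaps (mem_closedBall_self hr.1.le)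
  have hF : DiffContOnCl ℂ (fun w => discExt f w ^ 2) (ball 0 ρ) :=
    (DifferentiableOn.pow hf 2).diffContOnCl_ball (closedBall_subset_ball hρ.2)
  have hG : DiffContOnCl ℂ (discExt fun z => (φ z : ℂ)) (ball 0 r) :=
    hφ.diffContOnCl_ball (closedBall_subset_ball hr.2)
  have hsphere : EqOn (fun z => ‖discExt (f ∘ φ) z‖ ^ 2)
      (fun z => ‖discExt f (discExt (fun w => (φ w : ℂ)) z) ^ 2‖) (sphere 0 |r|) := fun z hz => by
    rw [abs_of_pos hr.1] at hz
    simp only [norm_pow, discExt_comp ((mem_sphere_zero_iff_norm.1 hz).trans_lt hr.2)]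
  rw [integralMean_eq (hf.comp hφ) hr, integralMean_eq hf hρ,
    ← ENNReal.ofReal_mul (div_nonneg (add_nonneg hρ.1.le (norm_nonneg _)) hρ_pos.le),
    circleAverage_congr_sphere hsphere]
  refine ENNReal.ofReal_le_ofReal ?_
  simpa only [norm_pow, sub_zero, hφ0] using circleAverage_norm_comp_le hr.1 hF hG hmaps

theorem eventually_mapsTo_ball_of_isCompact {X E : Type*} [TopologicalSpace X]
    [MetricSpace E] [ProperSpace E] {f : X → E} {K : Set X} {c : E} {R : ℝ}
    (hK : IsCompact K) (hf : ContinuousOn f K) (hmaps : MapsTo f K (ball c R)) :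
    ∀ᶠ ρ in 𝓝[<] R, MapsTo f K (ball c ρ) := by
  obtain ⟨ρ₀, hρ₀, hsub⟩ :=
    exists_lt_subset_ball (hK.image_of_continuousOn hf).isClosed hmaps.image_subset
  filter_upwards [Ioo_mem_nhdsLT hρ₀] with ρ hρ
  exact mapsTo_iff_image_subset.2 (hsub.trans (ball_subset_ball hρ.1.le))

theorem eHardyNorm_comp_sq_le {f : 𝔻 → ℂ} {φ : 𝔻 → 𝔻} (hf : IsHolomorphicOnDisc f)
    (hφ : IsHolomorphicOnDisc fun z => (φ z : ℂ)) :
    eHardyNorm (f ∘ φ) ^ 2 ≤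
      ENNReal.ofReal ((1 + ‖(φ 0 : ℂ)‖) / (1 - ‖(φ 0 : ℂ)‖)) * eHardyNorm f ^ 2 := by
  have hφ0 : 0 < 1 - ‖(φ 0 : ℂ)‖ := sub_pos.2 (φ 0).norm_lt_one
  rw [eHardyNorm_sq (f ∘ φ)]
  refine iSup₂_le fun r hr => ?_
  have hlim : Tendsto
      (fun ρ : ℝ => ENNReal.ofReal ((ρ + ‖(φ 0 : ℂ)‖) / (ρ - ‖(φ 0 : ℂ)‖)) * eHardyNorm f ^ 2)
      (𝓝[<] 1)
      (𝓝 (ENNReal.ofReal ((1 + ‖(φ 0 : ℂ)‖) / (1 - ‖(φ 0 : ℂ)‖)) * eHardyNorm f ^ 2)) := by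
    refine ENNReal.Tendsto.mul_const (ENNReal.tendsto_ofReal ?_)
      (.inl (ENNReal.ofReal_pos.2 (by positivity)).ne')
    have : ContinuousAt (fun ρ : ℝ => (ρ + ‖(φ 0 : ℂ)‖) / (ρ - ‖(φ 0 : ℂ)‖)) 1 :=
      ContinuousAt.div (by fun_prop) (by fun_prop) hφ0.ne'
    exact this.tendsto.mono_left nhdsWithin_le_nhds
  refine ge_of_tendsto hlim ?_
  have hsub : closedBall (0 : ℂ) r ⊆ ball 0 1 := closedBall_subset_ball hr.2
  filter_upwards [Ioo_mem_nhdsLT zero_lt_one, eventually_mapsTo_ball_of_isCompact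
    (isCompact_closedBall 0 r) (hφ.continuousOn.mono hsub)
    ((mapsTo_discExt_coe φ).mono_left hsub)] with ρ hρ hmaps
  exact (integralMean_comp_le hf hφ hr hρ hmaps).trans
    (mul_le_mul_right (integralMean_le_eHardyNorm_sq f hρ) _)

theorem eHardyNorm_comp_le {f : 𝔻 → ℂ} {φ : 𝔻 → 𝔻} (hf : IsHolomorphicOnDisc f)
    (hφ : IsHolomorphicOnDisc fun z => (φ z : ℂ)) :
    eHardyNorm (f ∘ φ) ≤
      ENNReal.ofReal √((1 + ‖(φ 0 : ℂ)‖) / (1 - ‖(φ 0 : ℂ)‖)) * eHardyNorm f := by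
  have hφ0 : 0 < 1 - ‖(φ 0 : ℂ)‖ := sub_pos.2 (φ 0).norm_lt_one
  rw [← ENNReal.pow_le_pow_left_iff two_ne_zero, mul_pow, ← ENNReal.ofReal_pow (by positivity),
    Real.sq_sqrt (by positivity)]
  exact eHardyNorm_comp_sq_le hf hφ

/-- The composition operator `f ↦ f ∘ φ` on the Hardy space. -/
def compositionOperator (φ : 𝔻 → 𝔻) (hφ : IsHolomorphicOnDisc fun z => (φ z : ℂ)) :
    HardySpace →L[ℂ] HardySpace :=
  LinearMap.mkContinuous
    { toFun := fun f => ⟨f ∘ φ, f.2.1.comp hφ, (eHardyNorm_comp_le f.2.1 hφ).trans_lt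
        (ENNReal.mul_lt_top ENNReal.ofReal_lt_top f.2.2)⟩
      map_add' := fun _ _ => rfl
      map_smul' := fun _ _ => rfl }
    √((1 + ‖(φ 0 : ℂ)‖) / (1 - ‖(φ 0 : ℂ)‖)) fun f => by
      have h := ENNReal.toReal_mono (ENNReal.mul_lt_top ENNReal.ofReal_lt_top f.2.2).ne
        (eHardyNorm_comp_le f.2.1 hφ)
      rwa [ENNReal.toReal_mul, ENNReal.toReal_ofReal (sqrt_nonneg _)] at h

theorem isCompositionOperator_compositionOperator {φ : 𝔻 → 𝔻}
    (hφ : IsHolomorphicOnDisc fun z => (φ z : ℂ)) :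
    IsCompositionOperator φ (compositionOperator φ hφ) :=
  fun _ _ => rfl

/-! ### Taylor coefficients -/

/-- The `k`-th coefficient of the Taylor series of `F` at `c`. -/
def taylorCoeff (F : ℂ → ℂ) (c : ℂ) (k : ℕ) : ℂ :=
  (k.factorial : ℂ)⁻¹ * iteratedDeriv k F c

theorem hasSum_taylorCoeff_mul_pow {F : ℂ → ℂ} {c z : ℂ} {R : ℝ}
    (hF : DifferentiableOn ℂ F (ball c R)) (hz : z ∈ ball c R) :
    HasSum (fun k => taylorCoeff F c k * (z - c) ^ k) (F z) := by
  simpa only [taylorCoeff, smul_eq_mul, mul_assoc, mul_comm ((z - c) ^ _)] using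
    hasSum_taylorSeries_on_ball hF hz

theorem fourierCoeffOn_comp_circleMap {F : ℂ → ℂ} {c : ℂ} {R : ℝ} (hR : 0 < R)
    (hF : DiffContOnCl ℂ F (ball c R)) (k : ℕ) :
    fourierCoeffOn two_pi_pos (fun θ => F (circleMap c R θ)) k = taylorCoeff F c k * R ^ k := by
  have hR' : (R : ℂ) ≠ 0 := ofReal_ne_zero.2 hR.ne'
  have hpi : (π : ℂ) ≠ 0 := ofReal_ne_zero.2 pi_ne_zero
  have hfourier (θ : ℝ) : fourier (-(k : ℤ)) (θ : AddCircle (2 * π - 0)) = (exp (θ * I))⁻¹ ^ k := by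
    rw [fourier_coe_apply, ← Complex.exp_neg, ← Complex.exp_nat_mul]
    congr 1
    push_cast
    field_simp
    ring
  have hintegrand (θ : ℝ) : deriv (circleMap c R) θ •
      (1 / (circleMap c R θ - c) ^ (k + 1)) • F (circleMap c R θ) =
      I / R ^ k * (fourier (-(k : ℤ)) (θ : AddCircle (2 * π - 0)) • F (circleMap c R θ)) := by
    rw [hfourier, deriv_circleMap, circleMap_sub_center]
    simp only [circleMap, zero_add, smul_eq_mul, inv_pow]
    generalize hexp : exp (θ * I) = e
    have he : e ≠ 0 := hexp ▸ Complex.exp_ne_zero _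
    field_simp
    ring
  have hcauchy := hF.circleIntegral_one_div_sub_center_pow_smul hR k
  simp only [circleIntegral, hintegrand, intervalIntegral.integral_const_mul] at hcauchy
  rw [fourierCoeffOn_eq_integral, taylorCoeff, real_smul]
  simp only [smul_eq_mul, sub_zero] at hcauchy ⊢
  push_cast
  field_simp at hcauchy ⊢
  linear_combination hcauchy

theorem sum_sq_norm_taylorCoeff_mul_pow_le {F : ℂ → ℂ} {c : ℂ} {R : ℝ} (hR : 0 < R)
    (hF : DiffContOnCl ℂ F (ball c R)) (s : Finset ℕ) :
    ∑ k ∈ s, ‖taylorCoeff F c k * R ^ k‖ ^ 2 ≤ circleAverage (fun z => ‖F z‖ ^ 2) c R := by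
  have hc : Continuous fun θ => F (circleMap c R θ) :=
    hF.continuousOn_ball.comp_continuous (continuous_circleMap c R)
      (circleMap_mem_closedBall c hR.le)
  have hL2 : MemLp (fun θ => F (circleMap c R θ)) 2 (volume.restrict (Ioc 0 (2 * π))) :=
    (memLp_two_iff_integrable_sq_norm hc.aestronglyMeasurable).2 (hc.norm.pow 2).integrableOn_Ioc
  have hparseval := hasSum_sq_fourierCoeffOn two_pi_pos hL2
  rw [sub_zero, ← circleAverage_def (f := fun z => ‖F z‖ ^ 2)] at hparseval
  simpa [fourierCoeffOn_comp_circleMap hR hF] using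
    sum_le_hasSum (s.map Nat.castEmbedding) (fun i _ => by positivity) hparseval

namespace HardySpace

theorem hasSum_taylorCoeff (f : HardySpace) (z : 𝔻) :
    HasSum (fun k => taylorCoeff (discExt f) 0 k * (z : ℂ) ^ k) (f z) := by
  simpa only [discExt_coe, sub_zero] using
    hasSum_taylorCoeff_mul_pow f.2.1 (mem_ball_zero_iff.2 z.norm_lt_one)

theorem sum_sq_norm_taylorCoeff_le (f : HardySpace) (s : Finset ℕ) :
    ∑ k ∈ s, ‖taylorCoeff (discExt f) 0 k‖ ^ 2 ≤ ‖f‖ ^ 2 := by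
  have hlim : Tendsto (fun r : ℝ => ∑ k ∈ s, ‖taylorCoeff (discExt f) 0 k * r ^ k‖ ^ 2)
      (𝓝[<] 1) (𝓝 (∑ k ∈ s, ‖taylorCoeff (discExt f) 0 k‖ ^ 2)) := by
    have hcont : Continuous fun r : ℝ =>
        ∑ k ∈ s, ‖taylorCoeff (discExt f) 0 k * (r : ℂ) ^ k‖ ^ 2 := by fun_prop
    simpa using (hcont.tendsto 1).mono_left nhdsWithin_le_nhds
  refine le_of_tendsto hlim ?_
  filter_upwards [Ioo_mem_nhdsLT zero_lt_one] with r hr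
  exact (sum_sq_norm_taylorCoeff_mul_pow_le hr.1
    (f.2.1.diffContOnCl_ball (closedBall_subset_ball hr.2)) s).trans (f.circleAverage_sq_norm_le hr)

theorem summable_sq_norm_taylorCoeff (f : HardySpace) :
    Summable fun k => ‖taylorCoeff (discExt f) 0 k‖ ^ 2 :=
  summable_of_sum_le (fun _ => by positivity) f.sum_sq_norm_taylorCoeff_le

theorem tsum_sq_norm_taylorCoeff_le (f : HardySpace) :
    ∑' k, ‖taylorCoeff (discExt f) 0 k‖ ^ 2 ≤ ‖f‖ ^ 2 :=
  Real.tsum_le_of_sum_le (fun _ => by positivity) f.sum_sq_norm_taylorCoeff_le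

end HardySpace

/-! ### Growth at the boundary -/

theorem summable_and_tsum_mul_pow_le {a : ℕ → ℝ} {x : ℝ} (ha : ∀ k, 0 ≤ a k) (hx : 0 ≤ x)
    (hx1 : x < 1) (hsum : Summable fun k => a k ^ 2) :
    (Summable fun k => a k * x ^ k) ∧
      ∑' k, a k * x ^ k ≤ √(∑' k, a k ^ 2) / √(1 - x ^ 2) := by
  have hgeom : HasSum (fun k => (x ^ k) ^ 2) (1 - x ^ 2)⁻¹ := by
    simpa only [← pow_mul, mul_comm] using
      hasSum_geometric_of_lt_one (sq_nonneg x) (by nlinarith : x ^ 2 < 1)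
  simpa only [rpow_two, hgeom.tsum_eq, ← sqrt_eq_rpow, sqrt_inv, ← div_eq_mul_inv] using
    Real.summable_and_inner_le_Lp_mul_Lq_tsum_of_nonneg .two_two ha (fun k => pow_nonneg hx k)
      (by simpa only [rpow_two] using hsum) (by simpa only [rpow_two] using hgeom.summable)

theorem norm_tsum_mul_pow_le {a : ℕ → ℂ} {z : ℂ} (hsum : Summable fun k => ‖a k‖ ^ 2)
    (hz : ‖z‖ < 1) : ‖∑' k, a k * z ^ k‖ ≤ √(∑' k, ‖a k‖ ^ 2) / √(1 - ‖z‖ ^ 2) := by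
  obtain ⟨hs, hle⟩ :=
    summable_and_tsum_mul_pow_le (fun k => norm_nonneg (a k)) (norm_nonneg z) hz hsum
  have hnorm (k : ℕ) : ‖a k * z ^ k‖ = ‖a k‖ * ‖z‖ ^ k := by rw [norm_mul, norm_pow]
  simp only [← hnorm] at hs hle
  exact (norm_tsum_le_tsum_norm hs).trans hle

theorem exists_norm_tsum_mul_pow_le {a : ℕ → ℂ} (hsum : Summable fun k => ‖a k‖ ^ 2) {η : ℝ}
    (hη : 0 < η) :
    ∃ C, ∀ z : ℂ, ‖z‖ < 1 → ‖∑' k, a k * z ^ k‖ ≤ C + η / √(1 - ‖z‖ ^ 2) := by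
  obtain ⟨N, hN⟩ := ((tendsto_sum_nat_add fun k => ‖a k‖ ^ 2).eventually
    (gt_mem_nhds (pow_pos hη 2))).exists
  refine ⟨∑ k ∈ Finset.range N, ‖a k‖, fun z hz => ?_⟩
  have hs : Summable fun k => a k * z ^ k := .of_norm <| by
    simpa only [norm_mul, norm_pow] using
      (summable_and_tsum_mul_pow_le (fun k => norm_nonneg (a k)) (norm_nonneg z) hz hsum).1
  have htail : ∑' k, a (k + N) * z ^ (k + N) = z ^ N * ∑' k, a (k + N) * z ^ k := by
    rw [← tsum_mul_left]
    exact tsum_congr fun k => by ring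
  rw [← hs.sum_add_tsum_nat_add N, htail]
  refine (norm_add_le _ _).trans (add_le_add ?_ ?_)
  · refine (norm_sum_le _ _).trans (Finset.sum_le_sum fun k _ => ?_)
    rw [norm_mul, norm_pow]
    exact mul_le_of_le_one_right (norm_nonneg _) (pow_le_one₀ (norm_nonneg _) hz.le)
  · calc ‖z ^ N * ∑' k, a (k + N) * z ^ k‖ ≤ ‖∑' k, a (k + N) * z ^ k‖ := by
          rw [norm_mul, norm_pow]
          exact mul_le_of_le_one_left (norm_nonneg _) (pow_le_one₀ (norm_nonneg _) hz.le)
      _ ≤ √(∑' k, ‖a (k + N)‖ ^ 2) / √(1 - ‖z‖ ^ 2) :=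
          norm_tsum_mul_pow_le ((summable_nat_add_iff N).2 hsum) hz
      _ ≤ η / √(1 - ‖z‖ ^ 2) := by
          gcongr
          exact Real.sqrt_le_iff.2 ⟨hη.le, hN.le⟩

namespace HardySpace

theorem norm_apply_le (f : HardySpace) (z : 𝔻) : ‖f z‖ ≤ ‖f‖ / √(1 - ‖(z : ℂ)‖ ^ 2) := by
  rw [← (f.hasSum_taylorCoeff z).tsum_eq]
  refine (norm_tsum_mul_pow_le f.summable_sq_norm_taylorCoeff z.norm_lt_one).trans ?_
  gcongr
  exact Real.sqrt_le_iff.2 ⟨norm_nonneg f, f.tsum_sq_norm_taylorCoeff_le⟩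

theorem exists_norm_apply_le (f : HardySpace) {η : ℝ} (hη : 0 < η) :
    ∃ C, ∀ z : 𝔻, ‖f z‖ ≤ C + η / √(1 - ‖(z : ℂ)‖ ^ 2) := by
  obtain ⟨C, hC⟩ := exists_norm_tsum_mul_pow_le f.summable_sq_norm_taylorCoeff hη
  refine ⟨C, fun z => ?_⟩
  rw [← (f.hasSum_taylorCoeff z).tsum_eq]
  exact hC z z.norm_lt_one

end HardySpace

/-! ### Failure of shadowing -/

/-- The sequence `n • d • e` with `d > 0` small is a pseudo-orbit of `T`. -/
theorem HasPositiveShadowing.exists_norm_pow_sub_smul_le {X : Type*} [NormedAddCommGroup X]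
    [NormedSpace ℂ X] {T : X →L[ℂ] X} (hT : HasPositiveShadowing T) {e : X} (he : T e = e) :
    ∃ y : X, ∃ C : ℝ, ∀ n : ℕ, 1 ≤ n → ‖(T ^ n) y - (n : ℂ) • e‖ ≤ C := by
  obtain ⟨δ, hδ, hshadow⟩ := hT 1 one_pos
  obtain ⟨d, hd, hde⟩ : ∃ d > 0, d * ‖e‖ ≤ δ := by
    refine ⟨δ / (1 + ‖e‖), by positivity, ?_⟩
    rw [div_mul_eq_mul_div, div_le_iff₀ (by positivity)]
    nlinarith [norm_nonneg e]
  have hd' : (d : ℂ) ≠ 0 := ofReal_ne_zero.2 hd.ne'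
  obtain ⟨y, hy⟩ := hshadow (fun n => (n : ℂ) • (d : ℂ) • e) fun n _ => by
    rw [map_smul, map_smul, he, ← sub_smul, Nat.cast_add_one, sub_add_cancel_left, neg_one_smul,
      norm_neg, norm_smul, Complex.norm_of_nonneg hd.le]
    exact hde
  refine ⟨(d : ℂ)⁻¹ • y, d⁻¹, fun n hn => ?_⟩
  have hrescale : (T ^ n) ((d : ℂ)⁻¹ • y) - (n : ℂ) • e =
      (d : ℂ)⁻¹ • ((T ^ n) y - (n : ℂ) • (d : ℂ) • e) := by
    rw [map_smul, smul_sub, smul_comm (n : ℂ) (d : ℂ) e, inv_smul_smul₀ hd']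
  rw [hrescale, norm_smul, norm_inv, Complex.norm_of_nonneg hd.le]
  exact mul_le_of_le_one_right (inv_nonneg.2 hd.le) (hy n hn)

theorem one_mem_hardySubmodule : (1 : 𝔻 → ℂ) ∈ hardySubmodule := by
  have hone : EqOn (discExt 1) 1 (ball 0 1) := fun z hz => by
    lift z to 𝔻 using mem_ball_zero_iff.1 hz
    exact discExt_coe 1 z
  have hhol : IsHolomorphicOnDisc 1 := (differentiableOn_const 1).congr hone
  refine ⟨hhol, ENNReal.rpow_lt_top_of_nonneg (by norm_num) (ne_top_of_le_ne_top
    ENNReal.one_ne_top (iSup₂_le fun r hr => ?_))⟩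
  have hsphere : EqOn (fun z => ‖discExt 1 z‖ ^ 2) (fun _ => 1) (sphere 0 |r|) := fun z hz => by
    rw [abs_of_pos hr.1] at hz
    simp only [hone (sphere_subset_ball hr.2 hz), Pi.one_apply, norm_one, one_pow]
  rw [integralMean_eq hhol hr, circleAverage_congr_sphere hsphere, circleAverage_const,
    ENNReal.ofReal_one]

instance : One HardySpace := ⟨⟨1, one_mem_hardySubmodule⟩⟩

namespace IsCompositionOperator

variable {φ : 𝔻 → 𝔻} {T : HardySpace →L[ℂ] HardySpace}

theorem pow_apply (hT : IsCompositionOperator φ T) (n : ℕ) (f : HardySpace) (z : 𝔻) :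
    (T ^ n) f z = f (φ^[n] z) := by
  induction n generalizing z with
  | zero => rfl
  | succ n ih => rw [pow_succ', mul_apply_eq_comp, hT, ih, Function.iterate_succ_apply]

theorem exists_norm_iterate_sub_natCast_le (hT : IsCompositionOperator φ T)
    (hshadow : HasPositiveShadowing T) (z : 𝔻) :
    ∃ (f : HardySpace) (C : ℝ), ∀ n : ℕ, 1 ≤ n → ‖f (φ^[n] z) - n‖ ≤ C := by
  obtain ⟨f, C, hC⟩ := hshadow.exists_norm_pow_sub_smul_le (HardySpace.ext fun z => hT 1 z)
  refine ⟨f, C / √(1 - ‖(z : ℂ)‖ ^ 2), fun n hn => ?_⟩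
  have hval : ((T ^ n) f - (n : ℂ) • 1 : HardySpace) z = f (φ^[n] z) - n := by
    rw [← hT.pow_apply]
    exact congrArg ((T ^ n) f z - ·) (mul_one (n : ℂ))
  rw [← hval]
  exact (HardySpace.norm_apply_le _ z).trans (by gcongr; exact hC n hn)

theorem not_hasPositiveShadowing (hT : IsCompositionOperator φ T) {z : 𝔻} {c : ℝ} (hc : 0 < c)
    (hz : ∃ᶠ n : ℕ in atTop, c / n ^ 2 ≤ 1 - ‖(φ^[n] z : ℂ)‖ ^ 2) :
    ¬ HasPositiveShadowing T := by
  intro hshadow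
  obtain ⟨f, C, hC⟩ := hT.exists_norm_iterate_sub_natCast_le hshadow z
  obtain ⟨C', hC'⟩ := f.exists_norm_apply_le (η := √c / 2) (by positivity)
  obtain ⟨n, hn, hlarge, hn1⟩ := (hz.and_eventually
    ((tendsto_natCast_atTop_atTop.eventually_gt_atTop (2 * (C + C'))).and
      (eventually_ge_atTop 1))).exists
  have hn0 : (0 : ℝ) < n := Nat.cast_pos.2 hn1
  have hnorm : (n : ℝ) ≤ C + ‖f (φ^[n] z)‖ := by
    have h := norm_sub_norm_le (n : ℂ) (f (φ^[n] z))
    rw [norm_sub_rev, Complex.norm_natCast] at h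
    linarith [hC n hn1]
  have hgrowth : √c / 2 / √(1 - ‖(φ^[n] z : ℂ)‖ ^ 2) ≤ n / 2 := by
    calc √c / 2 / √(1 - ‖(φ^[n] z : ℂ)‖ ^ 2) ≤ √c / 2 / √(c / n ^ 2) := by gcongr
      _ = n / 2 := by
        rw [sqrt_div hc.le, sqrt_sq hn0.le]
        field_simp
  linarith [hC' (φ^[n] z)]

end IsCompositionOperator

/-! ### Orbits of parabolic self-maps -/

theorem discr_eq_zero_of_existsUnique_smul_eq_self {K : Type*} [Field K] [IsAlgClosed K]
    [NeZero (2 : K)] [DecidableEq K] {g : GL (Fin 2) K} (h : ∃! p : OnePoint K, g • p = p) :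
    g.val.discr = 0 := by
  have hdiscr : g.val.discr = discrim (g 1 0) (g 1 1 - g 0 0) (-g 0 1) := by
    rw [Matrix.discr_fin_two, Matrix.trace_fin_two, Matrix.det_fin_two, discrim]
    ring
  have hfix (x : K) (hx : g 1 0 * (x * x) + (g 1 1 - g 0 0) * x + -g 0 1 = 0) :
      g • (x : OnePoint K) = x := by
    rw [← Matrix.GeneralLinearGroup.fixpointPolynomial_aeval_eq_zero_iff]
    simpa [Matrix.GeneralLinearGroup.fixpointPolynomial, sq, sub_eq_add_neg] using hx
  rw [hdiscr]
  by_cases hc : g 1 0 = 0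
  · have hinfty : g • OnePoint.infty = OnePoint.infty := OnePoint.smul_infty_eq_self_iff.2 hc
    suffices g 1 1 - g 0 0 = 0 by simp [discrim, hc, this]
    by_contra hne
    exact OnePoint.coe_ne_infty _
      (h.unique (hfix (g 0 1 / (g 1 1 - g 0 0)) (by rw [hc]; field_simp; ring)) hinfty)
  · obtain ⟨s, hs⟩ := IsAlgClosed.exists_pow_nat_eq
      (discrim (g 1 0) (g 1 1 - g 0 0) (-g 0 1)) two_pos
    have hroot := quadratic_eq_zero_iff hc (hs.symm.trans (sq s))
    have hroots := OnePoint.coe_injective <|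
      h.unique (hfix _ ((hroot _).2 (.inl rfl))) (hfix _ ((hroot _).2 (.inr rfl)))
    have h2 : (2 : K) ≠ 0 := two_ne_zero
    field_simp at hroots
    have hs0 : s = 0 := by
      refine (mul_eq_zero.1 (?_ : 2 * s = 0)).resolve_left h2
      linear_combination hroots
    rw [← hs, hs0, zero_pow two_ne_zero]

theorem isParabolic_of_existsUnique_smul_eq_self {K : Type*} [Field K] [IsAlgClosed K]
    [NeZero (2 : K)] [DecidableEq K] {g : GL (Fin 2) K} (h : ∃! p : OnePoint K, g • p = p) :
    g.IsParabolic := by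
  refine ⟨?_, discr_eq_zero_of_existsUnique_smul_eq_self h⟩
  rintro ⟨a, ha⟩
  have hinfty : g • OnePoint.infty = OnePoint.infty :=
    OnePoint.smul_infty_eq_self_iff.2 (by simp [← ha])
  have hzero : g • ((0 : K) : OnePoint K) = (0 : K) := by
    rw [← Matrix.GeneralLinearGroup.fixpointPolynomial_aeval_eq_zero_iff,
      Matrix.GeneralLinearGroup.fixpointPolynomial_eq_zero_iff.2 ⟨a, ha⟩, map_zero]
  exact OnePoint.coe_ne_infty _ (h.unique hzero hinfty)

theorem smul_smul_one_add_pow_of_sq_eq_zero {R A : Type*} [CommSemiring R] [Semiring A]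
    [Algebra R A] {N : A} (hN : N ^ 2 = 0) (l : R) (n : ℕ) :
    l • (l • (1 : A) + N) ^ n = l ^ n • (l • (1 : A) + (n : R) • N) := by
  induction n with
  | zero => simp
  | succ n ih =>
    rw [pow_succ, ← smul_mul_assoc, ih]
    simp only [add_mul, mul_add, smul_mul_assoc, mul_smul_comm, one_mul, mul_one, ← sq, hN,
      smul_zero, add_zero, smul_add, smul_smul]
    push_cast
    module

namespace IsInducedBy

variable {φ : 𝔻 → 𝔻} {g : GL (Fin 2) ℂ}

theorem isHolomorphicOnDisc (h : IsInducedBy φ g) : IsHolomorphicOnDisc fun z => (φ z : ℂ) := by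
  rw [isInducedBy_iff] at h
  have hmoebius : DifferentiableOn ℂ (fun z : ℂ => (g 0 0 * z + g 0 1) / (g 1 0 * z + g 1 1))
      (ball 0 1) := by
    refine DifferentiableOn.div (by fun_prop) (by fun_prop) fun z hz => ?_
    exact (h (UnitDisc.mk z (mem_ball_zero_iff.1 hz))).1
  refine hmoebius.congr fun z hz => ?_
  lift z to 𝔻 using mem_ball_zero_iff.1 hz
  rw [discExt_coe, (h z).2]

theorem iterate (h : IsInducedBy φ g) (n : ℕ) : IsInducedBy φ^[n] (g ^ n) := by
  induction n with
  | zero => intro z; simp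
  | succ n ih => intro z; rw [pow_succ', mul_smul, ih z, h, Function.iterate_succ_apply']

theorem exists_iterate_eq_div (h : IsInducedBy φ g) (hg : g.IsParabolic) (z : 𝔻) :
    ∃ a b l d : ℂ, ∀ n : ℕ,
      l + n * d ≠ 0 ∧ (φ^[n] z : ℂ) = (a + n * b) / (l + n * d) := by
  have hl := Matrix.GeneralLinearGroup.parabolicEigenvalue_ne_zero hg
  have hN := hg.sub_eigenvalue_sq_eq_zero
  set l := g.val.parabolicEigenvalue
  set N := g.val - Matrix.scalar (Fin 2) l with hNdef
  have hgN : g.val = l • (1 : Matrix (Fin 2) (Fin 2) ℂ) + N := by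
    rw [hNdef, Matrix.smul_one_eq_diagonal, Matrix.scalar_apply, add_sub_cancel]
  have hpow (n : ℕ) (i j : Fin 2) :
      (g ^ n) i j = l ^ n / l * (l * (1 : Matrix (Fin 2) (Fin 2) ℂ) i j + n * N i j) := by
    have hentry := congrArg (· i j) (smul_smul_one_add_pow_of_sq_eq_zero hN l n)
    simp only [← hgN, Matrix.smul_apply, Matrix.add_apply, smul_eq_mul] at hentry
    rw [div_mul_eq_mul_div, eq_div_iff hl, ← hentry, mul_comm]
    rfl
  refine ⟨l * z, N 0 0 * z + N 0 1, l, N 1 0 * z + N 1 1, fun n => ?_⟩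
  have hscale : l ^ n / l ≠ 0 := div_ne_zero (pow_ne_zero n hl) hl
  obtain ⟨hden, hval⟩ := (isInducedBy_iff _ _).1 (h.iterate n) z
  have hnum_eq : (g ^ n) 0 0 * (z : ℂ) + (g ^ n) 0 1 =
      l ^ n / l * (l * z + n * (N 0 0 * z + N 0 1)) := by
    rw [hpow, hpow, Matrix.one_apply_eq, Matrix.one_apply_ne zero_ne_one]
    ring
  have hden_eq : (g ^ n) 1 0 * (z : ℂ) + (g ^ n) 1 1 =
      l ^ n / l * (l + n * (N 1 0 * z + N 1 1)) := by
    rw [hpow, hpow, Matrix.one_apply_eq, Matrix.one_apply_ne one_ne_zero]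
    ring
  rw [hden_eq] at hden hval
  rw [hnum_eq, mul_div_mul_left _ _ hscale] at hval
  exact ⟨right_ne_zero_of_mul hden, hval⟩

end IsInducedBy

theorem exists_pos_eventually_le_eval_of_frequently_pos {p : Polynomial ℝ}
    (hp : ∃ᶠ x in atTop, 0 < p.eval x) : ∃ c > 0, ∀ᶠ x in atTop, c ≤ p.eval x := by
  rcases le_or_gt p.degree 0 with hdeg | hdeg
  · rw [Polynomial.eq_C_of_degree_le_zero hdeg] at hp ⊢
    simp only [Polynomial.eval_C] at hp ⊢
    exact ⟨_, hp.exists.choose_spec, .of_forall fun _ => le_rfl⟩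
  rcases le_total 0 p.leadingCoeff with hlead | hlead
  · exact ⟨1, one_pos,
      (p.tendsto_atTop_of_leadingCoeff_nonneg hdeg hlead).eventually_ge_atTop 1⟩
  · refine absurd ?_ hp
    filter_upwards [(p.tendsto_atBot_of_leadingCoeff_nonpos hdeg hlead).eventually_le_atBot 0]
      with x hx using hx.not_gt

theorem sq_norm_add_smul {E : Type*} [NormedAddCommGroup E] [InnerProductSpace ℝ E] (u v : E)
    (x : ℝ) : ‖u + x • v‖ ^ 2 = ‖u‖ ^ 2 + 2 * inner ℝ u v * x + ‖v‖ ^ 2 * x ^ 2 := by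
  rw [norm_add_sq_real, real_inner_smul_right, norm_smul, mul_pow, Real.norm_eq_abs, sq_abs]
  ring

theorem exists_eventually_le_one_sub_sq_norm_div {a b l d : ℂ}
    (h : ∃ᶠ n : ℕ in atTop, ‖a + n * b‖ < ‖l + n * d‖) :
    ∃ c > 0, ∀ᶠ n : ℕ in atTop, c / n ^ 2 ≤ 1 - ‖(a + n * b) / (l + n * d)‖ ^ 2 := by
  let p : Polynomial ℝ := .C (‖l‖ ^ 2 - ‖a‖ ^ 2) +
    .C (2 * inner ℝ l d - 2 * inner ℝ a b) * .X + .C (‖d‖ ^ 2 - ‖b‖ ^ 2) * .X ^ 2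
  have hp (n : ℕ) : p.eval (n : ℝ) = ‖l + n * d‖ ^ 2 - ‖a + n * b‖ ^ 2 := by
    rw [← ofReal_natCast, ← real_smul, ← real_smul, sq_norm_add_smul, sq_norm_add_smul]
    simp only [p, Polynomial.eval_add, Polynomial.eval_mul, Polynomial.eval_C, Polynomial.eval_X,
      Polynomial.eval_pow]
    ring
  obtain ⟨c, hc, hcp⟩ := exists_pos_eventually_le_eval_of_frequently_pos (p := p) <|
    tendsto_natCast_atTop_atTop.frequently <| h.mono fun n hn => by
      rw [hp, sub_pos]
      exact pow_lt_pow_left₀ hn (norm_nonneg _) two_ne_zero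
  refine ⟨c / (1 + ‖l‖ + ‖d‖) ^ 2, by positivity, ?_⟩
  filter_upwards [tendsto_natCast_atTop_atTop.eventually hcp, eventually_ge_atTop 1]
    with n hcn hn
  rw [hp] at hcn
  have hn1 : (1 : ℝ) ≤ n := Nat.one_le_cast.2 hn
  have hden : ‖l + n * d‖ ≤ (1 + ‖l‖ + ‖d‖) * n := by
    calc ‖l + n * d‖ ≤ ‖l‖ + n * ‖d‖ := by simpa using norm_add_le l (n * d)
      _ ≤ (1 + ‖l‖ + ‖d‖) * n := by nlinarith [norm_nonneg l]
  have hden_pos : 0 < ‖l + n * d‖ ^ 2 := by nlinarith [sq_nonneg ‖a + n * b‖]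
  calc c / (1 + ‖l‖ + ‖d‖) ^ 2 / n ^ 2 = c / ((1 + ‖l‖ + ‖d‖) * n) ^ 2 := by
        rw [div_div, mul_pow]
    _ ≤ c / ‖l + n * d‖ ^ 2 := by gcongr
    _ ≤ (‖l + n * d‖ ^ 2 - ‖a + n * b‖ ^ 2) / ‖l + n * d‖ ^ 2 := by gcongr
    _ = 1 - ‖(a + n * b) / (l + n * d)‖ ^ 2 := by
        rw [norm_div, div_pow, sub_div, div_self hden_pos.ne']

namespace IsParabolicSelfMap

variable {φ : 𝔻 → 𝔻}

theorem isHolomorphicOnDisc (hφ : IsParabolicSelfMap φ) :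
    IsHolomorphicOnDisc fun z => (φ z : ℂ) :=
  let ⟨_, hg, _⟩ := hφ
  hg.isHolomorphicOnDisc

theorem exists_eventually_le_one_sub_norm_sq (hφ : IsParabolicSelfMap φ) (z : 𝔻) :
    ∃ c > 0, ∀ᶠ n : ℕ in atTop, c / n ^ 2 ≤ 1 - ‖(φ^[n] z : ℂ)‖ ^ 2 := by
  obtain ⟨g, hg, hfix⟩ := hφ
  obtain ⟨a, b, l, d, horbit⟩ :=
    hg.exists_iterate_eq_div (isParabolic_of_existsUnique_smul_eq_self hfix) z
  simp only [(horbit _).2]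
  refine exists_eventually_le_one_sub_sq_norm_div (.of_forall fun n => ?_)
  have hlt := (φ^[n] z).norm_lt_one
  rwa [(horbit n).2, norm_div, div_lt_one (norm_pos_iff.2 (horbit n).1)] at hlt

end IsParabolicSelfMap

end HardyShadowing

end

theorem mainTheorem4_general {φ : Complex.UnitDisc → Complex.UnitDisc}
    (hφ : HardyShadowing.IsHolomorphicOnDisc fun z => (φ z : ℂ)) {z : Complex.UnitDisc} {c : ℝ}
    (hc : 0 < c) (hz : ∃ᶠ n : ℕ in Filter.atTop, c / n ^ 2 ≤ 1 - ‖(φ^[n] z : ℂ)‖ ^ 2) :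
    ∃ T : HardyShadowing.HardySpace →L[ℂ] HardyShadowing.HardySpace,
      HardyShadowing.IsCompositionOperator φ T ∧ ¬ HardyShadowing.HasPositiveShadowing T :=
  have hT := HardyShadowing.isCompositionOperator_compositionOperator hφ
  ⟨_, hT, hT.not_hasPositiveShadowing hc hz⟩

theorem mainTheorem4 (φ : Complex.UnitDisc → Complex.UnitDisc)
    (hφ : HardyShadowing.IsParabolicSelfMap φ) :
    ∃ T : HardyShadowing.HardySpace →L[ℂ] HardyShadowing.HardySpace,
      HardyShadowing.IsCompositionOperator φ T ∧ ¬ HardyShadowing.HasPositiveShadowing T := by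
  obtain ⟨c, hc, horbit⟩ := hφ.exists_eventually_le_one_sub_norm_sq 0
  exact mainTheorem4_general hφ.isHolomorphicOnDisc hc horbit.frequently
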